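/- Let $\Sigma$ be a finite alphabet. Consider the commutative regular expressions $e,f ::= 0 \mid 1 \mid a \mid e\cdot f \mid e\cup f \mid e^{*}$ with $a\in\Sigma$, interpreted as sets of Parikh vectors in $\mathbb{N}^{\Sigma}$: $[\![0]\!]=\emptyset$, $[\![1]\!]=\{0\}$, $[\![a]\!]=\{\mathbf{1}_a\}$ (the unit vector of $a$), $[\![e\cdot f]\!]=\{u+v : u\in[\![e]\!],\ v\in[\![f]\!]\}$, $[\![e\cup f]\!]=[\![e]\!]\cup[\![f]\!]$, and $[\![e^{*}]\!]$ is the set of all finite $\mathbb{N}$-linear combinations of vectors of $[\![e]\!]$. Let $\equiv$ be the smallest congruence on expressions that satisfies the axioms of commutative Kleene algebra: $\cdot$ is associative and commutative with unit $1$; $\cup$ is associative, commutative and idempotent with unit $0$; $0\cdot e\equiv 0$; $e\cdot(f\cup g)\equiv (e\cdot f)\cup(e\cdot g)$; $1\cup e\cdot e^{*}\leq e^{*}$; and $e\cdot f\leq f$ implies $e^{*}\cdot f\leq f$; here $e\leq f$ means $e\cup f\equiv f$. A vector $u\in\mathbb{N}^{\Sigma}$ is identified, up to $\equiv$, with the expression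 that is the product of its letters, each letter $a$ being taken $u_a$ times, and a finite set of vectors with the union of the corresponding expressions. An unambiguous linear expression is an expression of the form $u\cdot B^{*}$, where $u\in\mathbb{N}^{\Sigma}$ and $B\subseteq\mathbb{N}^{\Sigma}$ is a finite independent set, i.e. every vector has at most one decomposition as an $\mathbb{N}$-linear combination of the elements of $B$. **Proposition.** Let $f$ be an unambiguous linear expression. For every expression $e$ there are expressions $[e\wedge f]$ and $[e\setminus f]$ such that 1. $e\equiv[e\wedge f]\cup[e\setminus f]$, 2. $[\![\,[e\wedge f]\,]\!]\subseteq[\![f]\!]$, and 3. $[\![\,[e\setminus f]\,]\!]\subseteq[\![e]\!]\setminus[\![f]\!]$. -/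

import Mathlib

noncomputable section

namespace CKA

/-- Parikh vectors over the alphabet `A`. -/
abbrev Vec (A : Type*) := A → ℕ

/-- Commutative regular expressions over the alphabet `A`: the constants `0` and `1`, letters,
the commutative product (`add`, interpreted as vector addition), union (`join`) and star. -/
inductive Expr (A : Type*) where
  | zero : Expr A
  | one : Expr A
  | letter (a : A) : Expr A
  | add (e f : Expr A) : Expr A
  | join (e f : Expr A) : Expr A
  | star (e : Expr A) : Expr A

/-- `U*`: the set of all finite `ℕ`-linear combinations of vectors of `U`. -/
def iterate {A : Type*} (U : Set (Vec A)) : Set (Vec A) :=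
  {v | ∃ α : Vec A →₀ ℕ, (↑α.support : Set (Vec A)) ⊆ U ∧ v = α.sum (fun b n => n • b)}

/-- The interpretation of an expression as a set of Parikh vectors. -/
def sem {A : Type*} [DecidableEq A] : Expr A → Set (Vec A)
  | .zero => ∅
  | .one => {0}
  | .letter a => {Pi.single a 1}
  | .add e f => {w | ∃ u ∈ sem e, ∃ v ∈ sem f, w = u + v}
  | .join e f => sem e ∪ sem f
  | .star e => iterate (sem e)

/-- Provable equality: the smallest congruence on expressions that contains the axioms of
commutative Kleene algebra, where an inequality `e ≤ f` stands for `e ∪ f ≡ f`. -/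
inductive Provable {A : Type*} : Expr A → Expr A → Prop
  | refl (e : Expr A) : Provable e e
  | symm {e f : Expr A} : Provable e f → Provable f e
  | trans {e f g : Expr A} : Provable e f → Provable f g → Provable e g
  | congr_add {e e' f f' : Expr A} :
      Provable e e' → Provable f f' → Provable (.add e f) (.add e' f')
  | congr_join {e e' f f' : Expr A} :
      Provable e e' → Provable f f' → Provable (.join e f) (.join e' f')
  | congr_star {e e' : Expr A} : Provable e e' → Provable (.star e) (.star e')
  | add_assoc (e f g : Expr A) : Provable (.add e (.add f g)) (.add (.add e f) g)
  | add_comm (e f : Expr A) : Provable (.add e f) (.add f e)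
  | one_add (e : Expr A) : Provable (.add .one e) e
  | join_assoc (e f g : Expr A) : Provable (.join e (.join f g)) (.join (.join e f) g)
  | join_comm (e f : Expr A) : Provable (.join e f) (.join f e)
  | join_idem (e : Expr A) : Provable (.join e e) e
  | zero_join (e : Expr A) : Provable (.join .zero e) e
  | zero_add (e : Expr A) : Provable (.add .zero e) .zero
  | distrib (e f g : Expr A) :
      Provable (.add e (.join f g)) (.join (.add e f) (.add e g))
  /-- `1 ∪ e · e* ≤ e*` -/
  | star_unfold (e : Expr A) :
      Provable (.join (.join .one (.add e (.star e))) (.star e)) (.star e)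
  /-- `e · f ≤ f` implies `e* · f ≤ f` -/
  | star_induct {e f : Expr A} :
      Provable (.join (.add e f) f) f → Provable (.join (.add (.star e) f) f) f

/-- The product of a finite list of expressions; the empty product is `1`. -/
def sumList {A : Type*} (l : List (Expr A)) : Expr A := l.foldr Expr.add Expr.one

/-- The union of a finite list of expressions; the empty union is `0`. -/
def joinList {A : Type*} (l : List (Expr A)) : Expr A := l.foldr Expr.join Expr.zero

/-- The expression of a vector `u`, in which each letter `a` occurs `u a` times. -/
def vecExpr {A : Type*} [Fintype A] (u : Vec A) : Expr A :=
  sumList (Finset.univ.toList.map fun a => sumList (List.replicate (u a) (Expr.letter a)))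

/-- The expression of a finite set `B` of vectors: the union of their expressions. -/
def setExpr {A : Type*} [Fintype A] (B : Finset (Vec A)) : Expr A :=
  joinList (B.toList.map vecExpr)

/-- A finite set of vectors is independent if every vector has at most one decomposition as an
`ℕ`-linear combination of its elements. -/
def Independent {A : Type*} (B : Finset (Vec A)) : Prop :=
  Function.Injective fun α : {b // b ∈ B} → ℕ => ∑ b, α b • (b : Vec A)

/-- `f` is the linear expression `u · B*`. A vector and a finite set of vectors are identified
with the expressions that denote them up to provable equality, so that neither the order of the
letters nor an enumeration of `B` matters. -/
def IsLinearWith {A : Type*} [Fintype A] (f : Expr A) (u : Vec A) (B : Finset (Vec A)) : Prop :=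
  ∃ x y : Expr A, f = .add x (.star y) ∧ Provable x (vecExpr u) ∧ Provable y (setExpr B)

/-- `f` is an unambiguous linear expression: `f = u · B*` with `B` independent. -/
def IsUnambiguousLinear {A : Type*} [Fintype A] (f : Expr A) : Prop :=
  ∃ (u : Vec A) (B : Finset (Vec A)), Independent B ∧ IsLinearWith f u B

end CKA

end

/-! Pass to the free commutative Kleene algebra of expressions modulo `Provable` and call `x` split
by `D` if it is a sum of a part inside `D` and a part outside. Splitting by finitely many sets
yields splitting by their intersection, so it suffices to write `sem f` as an intersection of simple
conditions. Independence makes `B` linearly independent over `ℚ`; hence `w ∈ u + B*` says that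
finitely many additive maps `φ : Vec A →+ ℚ` satisfy `φ w = φ u` (`w - u` lies in the span of `B`)
or `φ w - φ u ∈ ℕ` (its coordinates are natural numbers). This is `splitBy_add_closure`. For one
`φ`, every element is a finite sum of terms `v * x∗ * z∗` with `φ` constant on `v` and on `x`, and
zero on `z` (`mem_gradedSums`). On such a term `φ` runs through an arithmetic progression indexed by
the exponent of `x`, and both conditions are eventually periodic along it, so cutting `x∗` by
exponent and residue splits the term (`splitBy_preimage`). -/

open Computability

/-! ### Identities of commutative Kleene algebra. -/

/-- A Kleene algebra whose multiplication is commutative. -/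
class CommKleeneAlgebra (K : Type*) extends KleeneAlgebra K, IdemCommSemiring K

namespace CommKleeneAlgebra

variable {K : Type*} [CommKleeneAlgebra K]

theorem kstar_add (a b : K) : (a + b)∗ = a∗ * b∗ := by
  apply le_antisymm
  · apply kstar_le_of_mul_le_right
    · exact one_le_mul one_le_kstar one_le_kstar
    · rw [add_mul]
      refine add_le ?_ ?_
      · rw [← mul_assoc]
        exact mul_le_mul_left mul_kstar_le_kstar _
      · rw [mul_left_comm]
        exact mul_le_mul_right mul_kstar_le_kstar _
  · calc a∗ * b∗ ≤ (a + b)∗ * (a + b)∗ :=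
        mul_le_mul' (kstar_mono le_self_add) (kstar_mono le_add_self)
      _ = (a + b)∗ := kstar_mul_kstar _

/-- As soon as one factor `a` occurs, the number of factors `b` is unconstrained; this removes
nested stars. -/
theorem kstar_mul_kstar_eq (a b : K) : (a * b∗)∗ = 1 + a * a∗ * b∗ := by
  apply le_antisymm
  · apply kstar_le_of_mul_le_right le_self_add
    rw [mul_add, mul_one]
    refine add_le ?_ ?_
    · refine le_trans ?_ le_add_self
      exact mul_le_mul_left (le_mul_of_one_le_right' one_le_kstar) _
    · refine le_trans ?_ le_add_self
      calc a * b∗ * (a * a∗ * b∗) = a * (a * a∗) * (b∗ * b∗) := by ring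
        _ ≤ a * a∗ * b∗ := by
          rw [kstar_mul_kstar]
          exact mul_le_mul_left (mul_le_mul_right mul_kstar_le_kstar _) _
  · refine add_le one_le_kstar ?_
    calc a * a∗ * b∗ = a∗ * (a * b∗) := by ring
      _ ≤ (a * b∗)∗ * (a * b∗) :=
        mul_le_mul_left (kstar_mono (le_mul_of_one_le_right' one_le_kstar)) _
      _ ≤ (a * b∗)∗ := kstar_mul_le_kstar

theorem mul_kstar_mul_add_le (a b : K) :
    a * ((a * b)∗ * (a∗ + b∗)) ≤ (a * b)∗ * (a∗ + b∗) := by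
  have h : a * ((a * b)∗ * (a∗ + b∗)) =
      (a * b)∗ * (a * a∗) + (a * b)∗ * a + (a * b * (a * b)∗) * b∗ := by
    calc _ = (a * b)∗ * (a * a∗) + (a * b)∗ * a * (1 + b * b∗) := by
          rw [one_add_mul_kstar]; ring
      _ = _ := by ring
  rw [h, mul_add]
  refine add_le (add_le ?_ ?_) ?_
  · exact (mul_le_mul_right mul_kstar_le_kstar _).trans le_self_add
  · exact (mul_le_mul_right le_kstar _).trans le_self_add
  · exact (mul_le_mul_left mul_kstar_le_kstar _).trans le_add_self

/-- In a monomial `a ^ i * b ^ j`, pair each `a` with a `b` until only one kind remains. -/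
theorem kstar_mul_kstar_swap (a b : K) : a∗ * b∗ = (a * b)∗ * (a∗ + b∗) := by
  apply le_antisymm
  · apply kstar_mul_le
    · calc b∗ ≤ 1 * (a∗ + b∗) := by rw [one_mul]; exact le_add_self
        _ ≤ _ := mul_le_mul_left one_le_kstar _
    · exact mul_kstar_mul_add_le a b
  · have h : (a * b)∗ ≤ a∗ * b∗ := by
      rw [← kstar_add]
      apply kstar_le_of_mul_le_right one_le_kstar
      rw [kstar_add]
      calc a * b * (a∗ * b∗) = (a * a∗) * (b * b∗) := by ring
        _ ≤ a∗ * b∗ := mul_le_mul' mul_kstar_le_kstar mul_kstar_le_kstar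
    calc (a * b)∗ * (a∗ + b∗) ≤ (a∗ * b∗) * (a∗ * b∗) :=
          mul_le_mul' h (add_le (le_mul_of_one_le_right' one_le_kstar)
            (le_mul_of_one_le_left' one_le_kstar))
      _ = (a∗ * a∗) * (b∗ * b∗) := by ring
      _ = a∗ * b∗ := by rw [kstar_mul_kstar, kstar_mul_kstar]

theorem kstar_eq_sum_range_add (a : K) (n : ℕ) :
    a∗ = ∑ i ∈ Finset.range n, a ^ i + a ^ n * a∗ := by
  induction n with
  | zero => simp
  | succ n ih =>
    rw [Finset.sum_range_succ, add_assoc, pow_succ, mul_assoc]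
    nth_rw 1 [ih]
    nth_rw 1 [← one_add_mul_kstar (a := a)]
    rw [mul_add, mul_one]

/-- Division with remainder of the exponent by `p`. -/
theorem kstar_eq_sum_range_mul (a : K) {p : ℕ} (hp : 0 < p) :
    a∗ = (∑ i ∈ Finset.range p, a ^ i) * (a ^ p)∗ := by
  obtain ⟨p, rfl⟩ := Nat.exists_eq_succ_of_ne_zero hp.ne'
  apply le_antisymm
  · apply kstar_le_of_mul_le_right
    · refine one_le_mul ?_ one_le_kstar
      rw [Finset.sum_range_succ', pow_zero]
      exact le_add_self
    · calc a * ((∑ i ∈ Finset.range (p + 1), a ^ i) * (a ^ (p + 1))∗)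
          = (∑ i ∈ Finset.range p, a ^ (i + 1)) * (a ^ (p + 1))∗
            + a ^ (p + 1) * (a ^ (p + 1))∗ := by
            rw [← mul_assoc, Finset.mul_sum, Finset.sum_range_succ, add_mul]
            simp_rw [pow_succ']
        _ ≤ (∑ i ∈ Finset.range p, a ^ (i + 1)) * (a ^ (p + 1))∗ + 1 * (a ^ (p + 1))∗ := by
            rw [one_mul]
            exact add_le_add_right mul_kstar_le_kstar _
        _ = _ := by rw [← add_mul, Finset.sum_range_succ', pow_zero]
  · have h1 : ∑ i ∈ Finset.range (p + 1), a ^ i ≤ a∗ := by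
      rw [kstar_eq_sum_range_add a (p + 1)]
      exact le_self_add
    have h2 : (a ^ (p + 1))∗ ≤ a∗ := by
      calc (a ^ (p + 1))∗ ≤ a∗∗ := kstar_mono pow_le_kstar
        _ = a∗ := kstar_idem a
    calc _ ≤ a∗ * a∗ := mul_le_mul' h1 h2
      _ = a∗ := kstar_mul_kstar a

end CommKleeneAlgebra

/-! ### Soundness of provable equality. -/

namespace CKA

variable {A : Type*}

theorem iterate_eq_closure (U : Set (Vec A)) : iterate U = AddSubmonoid.closure U := by
  classical
  ext v
  constructor
  · rintro ⟨α, hα, rfl⟩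
    exact AddSubmonoid.sum_mem _ fun b hb =>
      AddSubmonoid.nsmul_mem _ (AddSubmonoid.subset_closure (hα hb)) _
  · intro hv
    induction hv using AddSubmonoid.closure_induction with
    | mem x hx =>
      refine ⟨Finsupp.single x 1, ?_, by simp⟩
      intro y hy
      have := Finsupp.support_single_subset hy
      simp only [Finset.mem_singleton] at this
      exact this ▸ hx
    | zero => exact ⟨0, by simp, by simp⟩
    | add x y _ _ hx hy =>
      obtain ⟨α, hα, rfl⟩ := hx
      obtain ⟨β, hβ, rfl⟩ := hy
      refine ⟨α + β, ?_, ?_⟩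
      · intro z hz
        rcases Finset.mem_union.1 (Finsupp.support_add hz) with h | h
        · exact hα h
        · exact hβ h
      · rw [Finsupp.sum_add_index'] <;> simp [add_smul]

section Soundness

variable [DecidableEq A]

theorem sem_star (e : Expr A) : sem (.star e) = AddSubmonoid.closure (sem e) :=
  iterate_eq_closure _

theorem sem_join (e f : Expr A) : sem (.join e f) = sem e ∪ sem f := rfl

open Pointwise in
theorem sem_mul (e f : Expr A) : sem (.add e f) = sem e + sem f := by
  ext w
  simp only [sem, Set.mem_ofPred_eq, Set.mem_add]
  exact ⟨fun ⟨u, hu, v, hv, h⟩ => ⟨u, hu, v, hv, h.symm⟩,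
    fun ⟨u, hu, v, hv, h⟩ => ⟨u, hu, v, hv, h.symm⟩⟩

open Pointwise in
theorem Provable.sem_eq {e f : Expr A} (h : Provable e f) : sem e = sem f := by
  induction h with
  | refl => rfl
  | symm _ ih => exact ih.symm
  | trans _ _ ih₁ ih₂ => exact ih₁.trans ih₂
  | congr_add _ _ ih₁ ih₂ => rw [sem_mul, sem_mul, ih₁, ih₂]
  | congr_join _ _ ih₁ ih₂ => simp only [sem, ih₁, ih₂]
  | congr_star _ ih => simp only [sem, ih]
  | add_assoc e f g => simp only [sem_mul, _root_.add_assoc]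
  | add_comm e f => simp only [sem_mul, _root_.add_comm]
  | one_add e => rw [sem_mul]; simp [sem]
  | join_assoc e f g => simp only [sem, Set.union_assoc]
  | join_comm e f => simp only [sem, Set.union_comm]
  | join_idem e => simp only [sem, Set.union_self]
  | zero_join e => simp only [sem, Set.empty_union]
  | zero_add e => rw [sem_mul]; simp [sem]
  | distrib e f g => simp only [sem_mul, sem_join, Set.add_union]
  | star_unfold e =>
    rw [sem, Set.union_eq_right, sem, sem_mul, sem_star]
    refine Set.union_subset ?_ ?_
    · simp [sem]
    · rintro _ ⟨u, hu, v, hv, rfl⟩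
      exact AddSubmonoid.add_mem _ (AddSubmonoid.subset_closure hu) hv
  | @star_induct e f _ ih =>
    rw [sem, Set.union_eq_right, sem_mul] at ih
    rw [sem, Set.union_eq_right, sem_mul, sem_star]
    rintro _ ⟨u, hu, v, hv, rfl⟩
    induction hu using AddSubmonoid.closure_induction generalizing v with
    | mem x hx => exact ih ⟨x, hx, v, hv, rfl⟩
    | zero => simpa using hv
    | add x y _ _ hx hy =>
      change x + y + v ∈ sem f
      rw [_root_.add_assoc]
      exact hx _ (hy _ hv)

end Soundness

/-! ### The free commutative Kleene algebra and its languages. -/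

/-- Provable equality as a setoid. -/
def provableSetoid (A : Type*) : Setoid (Expr A) where
  r := Provable
  iseqv := ⟨Provable.refl, Provable.symm, Provable.trans⟩

/-- The free commutative Kleene algebra: expressions up to provable equality. -/
def Free (A : Type*) : Type _ := Quotient (provableSetoid A)

namespace Free

/-- The class of an expression. -/
def mk (e : Expr A) : Free A := Quotient.mk (provableSetoid A) e

theorem mk_eq_mk {e f : Expr A} : mk e = mk f ↔ Provable e f :=
  Quotient.eq (r := provableSetoid A)

theorem mk_surjective : Function.Surjective (mk : Expr A → Free A) := Quotient.mk_surjective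

instance : Zero (Free A) := ⟨mk .zero⟩
instance : One (Free A) := ⟨mk .one⟩
instance : Add (Free A) :=
  ⟨Quotient.map₂ Expr.join fun _ _ h _ _ h' => Provable.congr_join h h'⟩
instance : Mul (Free A) :=
  ⟨Quotient.map₂ Expr.add fun _ _ h _ _ h' => Provable.congr_add h h'⟩
instance : KStar (Free A) := ⟨Quotient.map Expr.star fun _ _ h => Provable.congr_star h⟩

protected theorem mul_comm (x y : Free A) : x * y = y * x := by
  induction x using Quotient.inductionOn with | _ e
  induction y using Quotient.inductionOn with | _ f
  exact mk_eq_mk.2 (.add_comm e f)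

protected theorem add_comm (x y : Free A) : x + y = y + x := by
  induction x using Quotient.inductionOn with | _ e
  induction y using Quotient.inductionOn with | _ f
  exact mk_eq_mk.2 (.join_comm e f)

protected theorem zero_add (x : Free A) : 0 + x = x := by
  induction x using Quotient.inductionOn with | _ e
  exact mk_eq_mk.2 (.zero_join e)

protected theorem one_mul (x : Free A) : 1 * x = x := by
  induction x using Quotient.inductionOn with | _ e
  exact mk_eq_mk.2 (.one_add e)

protected theorem zero_mul (x : Free A) : 0 * x = 0 := by
  induction x using Quotient.inductionOn with | _ e
  exact mk_eq_mk.2 (.zero_add e)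

protected theorem add_assoc (x y z : Free A) : x + y + z = x + (y + z) := by
  induction x using Quotient.inductionOn with | _ e
  induction y using Quotient.inductionOn with | _ f
  induction z using Quotient.inductionOn with | _ g
  exact mk_eq_mk.2 (.symm (.join_assoc e f g))

protected theorem mul_assoc (x y z : Free A) : x * y * z = x * (y * z) := by
  induction x using Quotient.inductionOn with | _ e
  induction y using Quotient.inductionOn with | _ f
  induction z using Quotient.inductionOn with | _ g
  exact mk_eq_mk.2 (.symm (.add_assoc e f g))

protected theorem mul_add (x y z : Free A) : x * (y + z) = x * y + x * z := by
  induction x using Quotient.inductionOn with | _ e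
  induction y using Quotient.inductionOn with | _ f
  induction z using Quotient.inductionOn with | _ g
  exact mk_eq_mk.2 (.distrib e f g)

protected theorem add_self (x : Free A) : x + x = x := by
  induction x using Quotient.inductionOn with | _ e
  exact mk_eq_mk.2 (.join_idem e)

instance : CommSemiring (Free A) where
  add_assoc := Free.add_assoc
  zero_add := Free.zero_add
  add_zero x := by rw [Free.add_comm, Free.zero_add]
  add_comm := Free.add_comm
  nsmul := nsmulRec
  left_distrib := Free.mul_add
  right_distrib x y z := by
    rw [Free.mul_comm, Free.mul_add, Free.mul_comm z, Free.mul_comm z]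
  zero_mul := Free.zero_mul
  mul_zero x := by rw [Free.mul_comm, Free.zero_mul]
  mul_assoc := Free.mul_assoc
  one_mul := Free.one_mul
  mul_one x := by rw [Free.mul_comm, Free.one_mul]
  mul_comm := Free.mul_comm

instance : IdemSemiring (Free A) := IdemSemiring.ofSemiring Free.add_self

theorem kstar_unfold_le (x : Free A) : 1 + x * x∗ ≤ x∗ := by
  induction x using Quotient.inductionOn with | _ e
  exact mk_eq_mk.2 (.star_unfold e)

theorem kstar_mul_le_of_mul_le (x y : Free A) (h : x * y ≤ y) : x∗ * y ≤ y := by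
  induction x using Quotient.inductionOn with | _ e
  induction y using Quotient.inductionOn with | _ f
  exact mk_eq_mk.2 (.star_induct (mk_eq_mk.1 h))

instance : CommKleeneAlgebra (Free A) where
  one_le_kstar x := (add_le_iff.1 (kstar_unfold_le x)).1
  mul_kstar_le_kstar x := (add_le_iff.1 (kstar_unfold_le x)).2
  kstar_mul_le_kstar x := by
    rw [_root_.mul_comm]
    exact (add_le_iff.1 (kstar_unfold_le x)).2
  kstar_mul_le_self := kstar_mul_le_of_mul_le
  mul_kstar_le_self x y h := by
    rw [_root_.mul_comm] at h ⊢
    exact kstar_mul_le_of_mul_le x y h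
  mul_comm := Free.mul_comm

variable [DecidableEq A]

/-- The set of vectors denoted by an element of the free commutative Kleene algebra. -/
def lang (x : Free A) : Set (Vec A) := Quotient.lift sem (fun _ _ h => Provable.sem_eq h) x

theorem lang_zero : lang (0 : Free A) = ∅ := rfl

theorem lang_one : lang (1 : Free A) = {0} := rfl

theorem lang_letter (a : A) : lang (mk (.letter a)) = {Pi.single a 1} := rfl

theorem lang_add (x y : Free A) : lang (x + y) = lang x ∪ lang y := by
  induction x using Quotient.inductionOn with | _ e
  induction y using Quotient.inductionOn with | _ f
  rfl

open Pointwise in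
theorem lang_mul (x y : Free A) : lang (x * y) = lang x + lang y := by
  induction x using Quotient.inductionOn with | _ e
  induction y using Quotient.inductionOn with | _ f
  exact sem_mul e f

theorem lang_kstar (x : Free A) : lang x∗ = AddSubmonoid.closure (lang x) := by
  induction x using Quotient.inductionOn with | _ e
  exact sem_star e

end Free
end CKA

/-! ### Decomposition into terms graded by an additive map. -/

namespace CKA
namespace Free

variable {A : Type*} [DecidableEq A]

/-- The additive map `φ` takes the constant value `c` on all vectors of `x`. -/
def HasValue (φ : Vec A →+ ℚ) (x : Free A) (c : ℚ) : Prop := ∀ w ∈ lang x, φ w = c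

namespace HasValue

variable {φ : Vec A →+ ℚ} {x y : Free A} {c d : ℚ}

theorem one : HasValue φ (1 : Free A) 0 := by
  intro w hw
  rw [lang_one, Set.mem_singleton_iff] at hw
  rw [hw, map_zero]

theorem letter (a : A) : HasValue φ (mk (.letter a)) (φ (Pi.single a 1)) := by
  intro w hw
  rw [lang_letter, Set.mem_singleton_iff] at hw
  rw [hw]

theorem zero : HasValue φ (0 : Free A) c := fun w hw => by
  rw [lang_zero] at hw
  exact hw.elim

theorem add (hx : HasValue φ x c) (hy : HasValue φ y c) : HasValue φ (x + y) c := by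
  intro w hw
  rw [lang_add] at hw
  exact hw.elim (hx w) (hy w)

theorem mul (hx : HasValue φ x c) (hy : HasValue φ y d) : HasValue φ (x * y) (c + d) := by
  intro w hw
  rw [lang_mul] at hw
  obtain ⟨u, hu, v, hv, rfl⟩ := hw
  rw [map_add, hx u hu, hy v hv]

theorem pow (hx : HasValue φ x c) (n : ℕ) : HasValue φ (x ^ n) (n * c) := by
  induction n with
  | zero => simpa using one
  | succ n ih =>
    rw [pow_succ, Nat.cast_succ, add_mul, one_mul]
    exact ih.mul hx

theorem exists_of_mem_kstar (hx : HasValue φ x c) {w : Vec A} (hw : w ∈ lang x∗) :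
    ∃ n : ℕ, φ w = n * c := by
  rw [lang_kstar] at hw
  induction hw using AddSubmonoid.closure_induction with
  | mem w hw => exact ⟨1, by rw [hx w hw, Nat.cast_one, one_mul]⟩
  | zero => exact ⟨0, by simp⟩
  | add v w _ _ hv hw =>
    obtain ⟨m, hm⟩ := hv
    obtain ⟨n, hn⟩ := hw
    exact ⟨m + n, by rw [map_add, hm, hn]; push_cast; ring⟩

theorem kstar (hx : HasValue φ x 0) : HasValue φ x∗ 0 := by
  intro w hw
  obtain ⟨n, hn⟩ := hx.exists_of_mem_kstar hw
  rw [hn, mul_zero]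

end HasValue

/-- The products `v * x∗ * z∗` in which `φ` is constant on `v` and on `x` and vanishes on `z`. -/
def gradedTerms (φ : Vec A →+ ℚ) : Set (Free A) :=
  {t | ∃ v x z c d, HasValue φ v c ∧ HasValue φ x d ∧ HasValue φ z 0 ∧ t = v * x∗ * z∗}

/-- The finite sums of graded terms. -/
def gradedSums (φ : Vec A →+ ℚ) : AddSubmonoid (Free A) := AddSubmonoid.closure (gradedTerms φ)

variable {φ : Vec A →+ ℚ}

theorem mem_gradedSums_of_hasValue {v x z : Free A} {c d : ℚ} (hv : HasValue φ v c)
    (hx : HasValue φ x d) (hz : HasValue φ z 0) : v * x∗ * z∗ ∈ gradedSums φ :=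
  AddSubmonoid.subset_closure ⟨v, x, z, c, d, hv, hx, hz, rfl⟩

theorem HasValue.mem_gradedSums {v : Free A} {c : ℚ} (hv : HasValue φ v c) :
    v ∈ gradedSums φ := by
  -- The unused starred factors are `0∗ = 1`; the empty language has every value.
  simpa using mem_gradedSums_of_hasValue hv (HasValue.zero (c := 0)) HasValue.zero

theorem HasValue.kstar_mem_gradedSums {x : Free A} {c : ℚ} (hx : HasValue φ x c) :
    x∗ ∈ gradedSums φ := by
  simpa using mem_gradedSums_of_hasValue HasValue.one hx HasValue.zero

theorem mul_kstar_mul_mem_gradedSums {v z y : Free A} {c : ℚ} (hv : HasValue φ v c)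
    (hz : HasValue φ z 0) (hy : y ∈ gradedSums φ) : v * z∗ * y ∈ gradedSums φ := by
  induction hy using AddSubmonoid.closure_induction with
  | mem y hy =>
    obtain ⟨v', x, z', c', d, hv', hx, hz', rfl⟩ := hy
    have h : v * z∗ * (v' * x∗ * z'∗) = v * v' * x∗ * (z + z')∗ := by
      rw [CommKleeneAlgebra.kstar_add]; ring
    rw [h]
    exact mem_gradedSums_of_hasValue (hv.mul hv') hx (hz.add hz')
  | zero => rw [mul_zero]; exact zero_mem _
  | add y y' _ _ ih ih' => rw [mul_add]; exact add_mem ih ih'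

theorem HasValue.mul_mem_gradedSums {v y : Free A} {c : ℚ} (hv : HasValue φ v c)
    (hy : y ∈ gradedSums φ) : v * y ∈ gradedSums φ := by
  simpa using mul_kstar_mul_mem_gradedSums hv HasValue.zero hy

/-- Equal values merge into one star `(x + y)∗`. Opposite values make `x * y` a value-zero element,
and pairing leaves a star of only one of `x`, `y`. -/
theorem kstar_mul_kstar_mem_of_eq_or_neg {x y : Free A} {c d : ℚ} (hx : HasValue φ x c)
    (hy : HasValue φ y d) (h : c = d ∨ c + d = 0) : x∗ * y∗ ∈ gradedSums φ := by
  rcases h with rfl | h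
  · rw [← CommKleeneAlgebra.kstar_add]
    exact (hx.add hy).kstar_mem_gradedSums
  · have hxy : HasValue φ (x * y) 0 := h ▸ hx.mul hy
    rw [CommKleeneAlgebra.kstar_mul_kstar_swap, ← one_mul ((x * y)∗)]
    exact mul_kstar_mul_mem_gradedSums HasValue.one hxy
      (add_mem hx.kstar_mem_gradedSums hy.kstar_mem_gradedSums)

end Free

theorem _root_.Rat.exists_nat_mul_eq_or_add_eq_zero {c d : ℚ} (hc : c ≠ 0) (hd : d ≠ 0) :
    ∃ m n : ℕ, 0 < m ∧ 0 < n ∧ ((m : ℚ) * c = n * d ∨ (m : ℚ) * c + n * d = 0) := by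
  -- Then `m * c = |d.num| * c.num` and `n * d = |c.num| * d.num`, which agree up to sign.
  refine ⟨d.num.natAbs * c.den, c.num.natAbs * d.den,
    Nat.mul_pos (by simpa using hd) c.den_pos,
    Nat.mul_pos (by simpa using hc) d.den_pos, ?_⟩
  have h : ∀ a b : ℚ, ((a.num.natAbs * b.den : ℕ) : ℚ) * b = ((|a.num| * b.num : ℤ) : ℚ) := by
    intro a b
    rw [Nat.cast_mul, mul_assoc, Rat.den_mul_eq_num, Int.cast_mul, Nat.cast_natAbs]
  rw [h, h]
  norm_cast
  rcases abs_choice c.num with hc | hc <;> rcases abs_choice d.num with hd | hd <;>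
    rw [hc, hd] <;> [left; right; right; left] <;> ring

namespace Free

variable {A : Type*} [DecidableEq A] {φ : Vec A →+ ℚ}

/-- If both values are nonzero, replacing `x`, `y` by suitable powers makes the values equal or
opposite; the remainders of the exponents are absorbed in the constant factor. -/
theorem kstar_mul_kstar_mem_gradedSums {x y : Free A} {c d : ℚ} (hx : HasValue φ x c)
    (hy : HasValue φ y d) : x∗ * y∗ ∈ gradedSums φ := by
  rcases eq_or_ne c 0 with rfl | hc
  · rw [← one_mul (x∗)]
    exact mul_kstar_mul_mem_gradedSums HasValue.one hx hy.kstar_mem_gradedSums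
  rcases eq_or_ne d 0 with rfl | hd
  · rw [mul_comm, ← one_mul (y∗)]
    exact mul_kstar_mul_mem_gradedSums HasValue.one hy hx.kstar_mem_gradedSums
  obtain ⟨m, n, hm, hn, h⟩ := Rat.exists_nat_mul_eq_or_add_eq_zero hc hd
  rw [CommKleeneAlgebra.kstar_eq_sum_range_mul x hm,
    CommKleeneAlgebra.kstar_eq_sum_range_mul y hn, mul_mul_mul_comm, Finset.sum_mul_sum,
    Finset.sum_mul]
  refine sum_mem fun i _ => ?_
  rw [Finset.sum_mul]
  exact sum_mem fun j _ => ((hx.pow i).mul (hy.pow j)).mul_mem_gradedSums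
    (kstar_mul_kstar_mem_of_eq_or_neg (hx.pow m) (hy.pow n) h)

theorem mul_mem_gradedSums {x y : Free A} (hx : x ∈ gradedSums φ) (hy : y ∈ gradedSums φ) :
    x * y ∈ gradedSums φ := by
  induction hx, hy using AddSubmonoid.closure_induction₂ with
  | mem s t hs ht =>
    obtain ⟨v, x, z, c, d, hv, hx, hz, rfl⟩ := hs
    obtain ⟨v', x', z', c', d', hv', hx', hz', rfl⟩ := ht
    have h : v * x∗ * z∗ * (v' * x'∗ * z'∗) = v * v' * (z + z')∗ * (x∗ * x'∗) := by
      rw [CommKleeneAlgebra.kstar_add]; ring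
    rw [h]
    exact mul_kstar_mul_mem_gradedSums (hv.mul hv') (hz.add hz')
      (kstar_mul_kstar_mem_gradedSums hx hx')
  | zero_left y _ => rw [zero_mul]; exact zero_mem _
  | zero_right x _ => rw [mul_zero]; exact zero_mem _
  | add_left x y z _ _ _ h h' => rw [add_mul]; exact add_mem h h'
  | add_right x y z _ _ _ h h' => rw [mul_add]; exact add_mem h h'

theorem kstar_mem_gradedSums {x : Free A} (hx : x ∈ gradedSums φ) : x∗ ∈ gradedSums φ := by
  induction hx using AddSubmonoid.closure_induction with
  | mem t ht =>
    obtain ⟨v, x, z, c, d, hv, hx, hz, rfl⟩ := ht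
    have h : v * x∗ * z∗ = v * (x + z)∗ := by
      rw [CommKleeneAlgebra.kstar_add, mul_assoc]
    rw [h, CommKleeneAlgebra.kstar_mul_kstar_eq, CommKleeneAlgebra.kstar_add]
    exact add_mem HasValue.one.mem_gradedSums (mul_mem_gradedSums
      (mul_mem_gradedSums hv.mem_gradedSums hv.kstar_mem_gradedSums)
      (mul_mem_gradedSums hx.kstar_mem_gradedSums hz.kstar_mem_gradedSums))
  | zero => rw [kstar_zero]; exact HasValue.one.mem_gradedSums
  | add x y _ _ hx hy => rw [CommKleeneAlgebra.kstar_add]; exact mul_mem_gradedSums hx hy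

theorem mem_gradedSums (φ : Vec A →+ ℚ) (x : Free A) : x ∈ gradedSums φ := by
  obtain ⟨e, rfl⟩ := mk_surjective x
  induction e with
  | zero => exact zero_mem _
  | one => exact HasValue.one.mem_gradedSums
  | letter a => exact (HasValue.letter a).mem_gradedSums
  | add e f he hf => exact mul_mem_gradedSums he hf
  | join e f he hf => exact add_mem he hf
  | star e he => exact kstar_mem_gradedSums he

/-! ### Splitting along sets of vectors. -/

/-- The elements that are the sum of a part inside `D` and a part outside `D`. -/
def splitBy (D : Set (Vec A)) : AddSubmonoid (Free A) where
  carrier := {x | ∃ y z, x = y + z ∧ lang y ⊆ D ∧ lang z ⊆ Dᶜ}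
  zero_mem' := ⟨0, 0, (add_zero 0).symm, by simp [lang_zero], by simp [lang_zero]⟩
  add_mem' := by
    rintro _ _ ⟨y, z, rfl, hy, hz⟩ ⟨y', z', rfl, hy', hz'⟩
    refine ⟨y + y', z + z', add_add_add_comm y z y' z', ?_, ?_⟩
    · rw [lang_add]; exact Set.union_subset hy hy'
    · rw [lang_add]; exact Set.union_subset hz hz'

theorem mem_splitBy_of_subset {D : Set (Vec A)} {x : Free A} (h : lang x ⊆ D) : x ∈ splitBy D :=
  ⟨x, 0, (add_zero x).symm, h, by simp [lang_zero]⟩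

theorem mem_splitBy_of_subset_compl {D : Set (Vec A)} {x : Free A} (h : lang x ⊆ Dᶜ) :
    x ∈ splitBy D :=
  ⟨0, x, (zero_add x).symm, by simp [lang_zero], h⟩

theorem splitBy_inter {D E : Set (Vec A)} (hD : splitBy D = ⊤) (hE : splitBy E = ⊤) :
    splitBy (D ∩ E) = ⊤ := by
  rw [AddSubmonoid.eq_top_iff'] at *
  intro x
  obtain ⟨y, z, rfl, hy, hz⟩ := hD x
  obtain ⟨y₁, y₂, rfl, h₁, h₂⟩ := hE y
  rw [lang_add, Set.union_subset_iff] at hy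
  refine add_mem (add_mem (mem_splitBy_of_subset (Set.subset_inter hy.1 h₁))
    (mem_splitBy_of_subset_compl fun w hw h => h₂ hw h.2))
    (mem_splitBy_of_subset_compl fun w hw h => hz hw h.1)

theorem splitBy_univ : splitBy (Set.univ : Set (Vec A)) = ⊤ :=
  (AddSubmonoid.eq_top_iff' _).2 fun _ => mem_splitBy_of_subset (Set.subset_univ _)

theorem splitBy_iInter {ι : Type*} [Finite ι] {D : ι → Set (Vec A)}
    (hD : ∀ i, splitBy (D i) = ⊤) : splitBy (⋂ i, D i) = ⊤ := by
  classical
  cases nonempty_fintype ι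
  have h : ∀ s : Finset ι, splitBy (⋂ i ∈ s, D i) = ⊤ := by
    intro s
    induction s using Finset.induction_on with
    | empty => simpa using splitBy_univ
    | insert i s _ ih =>
      rw [Finset.set_biInter_insert]
      exact splitBy_inter (hD i) ih
  simpa using h Finset.univ

/-- A set of rationals that is eventually periodic along every arithmetic progression. -/
def EventuallyPeriodic (T : Set ℚ) : Prop :=
  ∀ c d : ℚ, ∃ N p : ℕ, 0 < p ∧ ∀ n ≥ N, (c + ((n + p : ℕ) : ℚ) * d ∈ T ↔ c + (n : ℚ) * d ∈ T)

theorem HasValue.mem_splitBy_preimage {v : Free A} {c : ℚ} (hv : HasValue φ v c) (T : Set ℚ) :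
    v ∈ splitBy (φ ⁻¹' T) := by
  by_cases h : c ∈ T
  · exact mem_splitBy_of_subset fun w hw => by rw [Set.mem_preimage, hv w hw]; exact h
  · exact mem_splitBy_of_subset_compl fun w hw => by
      rw [Set.mem_compl_iff, Set.mem_preimage, hv w hw]; exact h

theorem splitBy_preimage (φ : Vec A →+ ℚ) {T : Set ℚ} (hT : EventuallyPeriodic T) :
    splitBy (φ ⁻¹' T) = ⊤ := by
  rw [AddSubmonoid.eq_top_iff']
  intro x
  have hx := mem_gradedSums φ x
  induction hx using AddSubmonoid.closure_induction with
  | zero => exact zero_mem _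
  | add x y _ _ hx hy => exact add_mem hx hy
  | mem t ht =>
    obtain ⟨v, x, z, c, d, hv, hx, hz, rfl⟩ := ht
    obtain ⟨N, p, hp, hN⟩ := hT c d
    have hper : ∀ k n, N ≤ n → (c + ((n + k * p : ℕ) : ℚ) * d ∈ T ↔ c + (n : ℚ) * d ∈ T) := by
      intro k
      induction k with
      | zero => simp
      | succ k ih =>
        intro n hn
        rw [← ih n hn, ← hN (n + k * p) (by omega)]
        ring_nf
    -- Exponents below `N` one at a time, then one block for each residue modulo `p`.
    have hsplit : v * x∗ * z∗ = ∑ i ∈ Finset.range N, v * x ^ i * z∗ +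
        ∑ i ∈ Finset.range p, v * x ^ (N + i) * (x ^ p)∗ * z∗ := by
      rw [CommKleeneAlgebra.kstar_eq_sum_range_add x N]
      nth_rw 1 [CommKleeneAlgebra.kstar_eq_sum_range_mul x hp]
      simp only [Finset.mul_sum, Finset.sum_mul, mul_add, add_mul, pow_add, mul_assoc]
    rw [hsplit]
    refine add_mem (sum_mem fun i _ => ((hv.mul (hx.pow i)).mul hz.kstar).mem_splitBy_preimage T)
      (sum_mem fun i _ => ?_)
    have hval : ∀ w ∈ lang (v * x ^ (N + i) * (x ^ p)∗ * z∗),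
        (φ w ∈ T ↔ c + ((N + i : ℕ) : ℚ) * d ∈ T) := by
      intro w hw
      rw [lang_mul, lang_mul] at hw
      obtain ⟨_, ⟨u, hu, w, hw, rfl⟩, s, hs, rfl⟩ := hw
      obtain ⟨k, hk⟩ := (hx.pow p).exists_of_mem_kstar hw
      have hφ : φ (u + w + s) = c + ((N + i + k * p : ℕ) : ℚ) * d := by
        rw [map_add, map_add, (hv.mul (hx.pow (N + i))) u hu, hk, hz.kstar s hs]
        push_cast
        ring
      change φ (u + w + s) ∈ T ↔ _
      rw [hφ]
      exact hper k (N + i) (by omega)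
    by_cases h : c + ((N + i : ℕ) : ℚ) * d ∈ T
    · exact mem_splitBy_of_subset fun w hw => (hval w hw).2 h
    · exact mem_splitBy_of_subset_compl fun w hw hw' => h ((hval w hw).1 hw')

theorem eventuallyPeriodic_Ici (r : ℚ) : EventuallyPeriodic (Set.Ici r) := by
  intro c d
  rcases lt_trichotomy d 0 with hd | rfl | hd
  · obtain ⟨N, hN⟩ := exists_nat_gt ((c - r) / -d)
    have key : ∀ n : ℕ, N ≤ n → ¬ r ≤ c + (n : ℚ) * d := by
      intro n hn h
      have hn' : (N : ℚ) ≤ n := by exact_mod_cast hn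
      rw [div_lt_iff₀ (by linarith)] at hN
      nlinarith
    exact ⟨N, 1, one_pos, fun n hn => iff_of_false (key _ (by omega)) (key _ hn)⟩
  · exact ⟨0, 1, one_pos, by simp⟩
  · obtain ⟨N, hN⟩ := exists_nat_gt ((r - c) / d)
    have key : ∀ n : ℕ, N ≤ n → r ≤ c + (n : ℚ) * d := by
      intro n hn
      have hn' : (N : ℚ) ≤ n := by exact_mod_cast hn
      rw [div_lt_iff₀ hd] at hN
      nlinarith
    exact ⟨N, 1, one_pos, fun n hn => iff_of_true (key _ (by omega)) (key _ hn)⟩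

theorem eventuallyPeriodic_sub_mem_range_intCast (r : ℚ) :
    EventuallyPeriodic {t | t - r ∈ Set.range ((↑) : ℤ → ℚ)} := by
  intro c d
  -- `d.den` steps of size `d` move by the integer `d.num`.
  refine ⟨0, d.den, d.den_pos, fun n _ => ?_⟩
  have h : c + ((n + d.den : ℕ) : ℚ) * d - r = c + (n : ℚ) * d - r + d.num := by
    push_cast
    rw [add_mul, Rat.den_mul_eq_num]
    ring
  simp only [Set.mem_ofPred_eq, Set.mem_range]
  rw [h]
  constructor
  · rintro ⟨k, hk⟩
    exact ⟨k - d.num, by push_cast; linarith⟩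
  · rintro ⟨k, hk⟩
    exact ⟨k + d.num, by push_cast; linarith⟩

theorem splitBy_le (φ : Vec A →+ ℚ) (u : Vec A) : splitBy {w | φ u ≤ φ w} = ⊤ :=
  splitBy_preimage φ (eventuallyPeriodic_Ici (φ u))

theorem splitBy_eq (φ : Vec A →+ ℚ) (u : Vec A) : splitBy {w | φ u = φ w} = ⊤ := by
  have h : {w | φ u = φ w} = {w | φ u ≤ φ w} ∩ {w | (-φ) u ≤ (-φ) w} := by
    ext w
    simp [le_antisymm_iff]
  rw [h]
  exact splitBy_inter (splitBy_le φ u) (splitBy_le (-φ) u)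

theorem splitBy_eq_add_natCast (φ : Vec A →+ ℚ) (u : Vec A) :
    splitBy {w | ∃ n : ℕ, φ w = φ u + n} = ⊤ := by
  have h : {w | ∃ n : ℕ, φ w = φ u + n} =
      {w | φ u ≤ φ w} ∩ φ ⁻¹' {t | t - φ u ∈ Set.range ((↑) : ℤ → ℚ)} := by
    ext w
    constructor
    · rintro ⟨n, hn⟩
      exact ⟨by simp [hn], n, by simp [hn]⟩
    · rintro ⟨h, k, hk⟩
      replace h : φ u ≤ φ w := h
      have hk0 : 0 ≤ k := by
        have : (0 : ℚ) ≤ k := by rw [hk]; linarith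
        exact_mod_cast this
      lift k to ℕ using hk0
      exact ⟨k, by push_cast at hk; linarith⟩
  rw [h]
  exact splitBy_inter (splitBy_le φ u)
    (splitBy_preimage φ (eventuallyPeriodic_sub_mem_range_intCast (φ u)))

end Free
end CKA

/-! ### Linear sets as intersections of conditions on additive maps. -/

namespace CKA

section Semantics

variable {A : Type*} [DecidableEq A]

open Pointwise in
theorem sem_sumList (l : List (Expr A)) : sem (sumList l) = (l.map sem).sum := by
  induction l with
  | nil => rfl
  | cons e l ih =>
    rw [List.map_cons, List.sum_cons, ← ih, ← sem_mul]
    rfl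

theorem mem_sem_joinList {l : List (Expr A)} {w : Vec A} :
    w ∈ sem (joinList l) ↔ ∃ e ∈ l, w ∈ sem e := by
  induction l with
  | nil => simp [joinList, sem]
  | cons e l ih =>
    rw [List.exists_mem_cons_iff, ← ih]
    exact Set.mem_union _ _ _

open Pointwise in
theorem sum_map_singleton {M ι : Type*} [AddCommMonoid M] (l : List ι) (f : ι → M) :
    (l.map fun i => ({f i} : Set M)).sum = {(l.map f).sum} := by
  induction l with
  | nil => rfl
  | cons i l ih => rw [List.map_cons, List.sum_cons, ih, Set.singleton_add_singleton,
      List.map_cons, List.sum_cons]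

open Pointwise in
theorem sem_vecExpr [Fintype A] (u : Vec A) : sem (vecExpr u) = {u} := by
  have h : ∀ a : A, sem (sumList (List.replicate (u a) (Expr.letter a))) = {Pi.single a (u a)} := by
    intro a
    rw [sem_sumList, List.map_replicate]
    induction u a with
    | zero => simp; rfl
    | succ n ih =>
      rw [List.replicate_succ, List.sum_cons, ih, sem, Set.singleton_add_singleton,
        ← Pi.single_add, Nat.add_comm]
  rw [vecExpr, sem_sumList, List.map_map]
  simp only [Function.comp_def, h]
  rw [sum_map_singleton, Finset.sum_map_toList, Finset.univ_sum_single]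

theorem sem_setExpr [Fintype A] (B : Finset (Vec A)) : sem (setExpr B) = B := by
  ext w
  simp [setExpr, mem_sem_joinList, sem_vecExpr]

theorem IsLinearWith.mem_sem_iff [Fintype A] {f : Expr A} {u : Vec A} {B : Finset (Vec A)}
    (h : IsLinearWith f u B) {w : Vec A} :
    w ∈ sem f ↔ ∃ s ∈ AddSubmonoid.closure (B : Set (Vec A)), w = u + s := by
  obtain ⟨x, y, rfl, hx, hy⟩ := h
  rw [sem_mul, sem_star, hx.sem_eq, hy.sem_eq, sem_vecExpr, sem_setExpr]
  simp [eq_comm]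

end Semantics

section Linear

variable {A : Type*}

/-- The inclusion of `ℕ`-valued into `ℚ`-valued vectors. -/
def ratCast (A : Type*) : Vec A →+ (A → ℚ) where
  toFun w a := w a
  map_zero' := by ext; simp
  map_add' v w := by ext; simp

theorem ratCast_apply (w : Vec A) (a : A) : ratCast A w a = w a := rfl

theorem ratCast_injective : Function.Injective (ratCast A) := fun v w h => by
  ext a
  exact Nat.cast_injective (congrFun h a)

theorem Independent.linearIndependent {B : Finset (Vec A)} (hB : Independent B) :
    LinearIndependent ℚ fun b : {b // b ∈ B} => ratCast A b := by
  -- With denominators cleared, the positive and negative parts of an integer relation are two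
  -- `ℕ`-decompositions of one vector.
  rw [← LinearIndependent.iff_fractionRing ℤ ℚ, Fintype.linearIndependent_iff]
  intro g hg
  have h : (fun b => (g b).toNat) = fun b => (-g b).toNat := by
    apply hB
    ext a
    have ha : ∑ b, (g b : ℚ) * ((b : Vec A) a : ℚ) = 0 := by
      simpa [Finset.sum_apply, ratCast_apply] using congrFun hg a
    beta_reduce
    rw [Finset.sum_apply, Finset.sum_apply]
    simp only [Pi.smul_apply, smul_eq_mul]
    have hg' : ∀ b, (g b : ℚ) = ((g b).toNat : ℚ) - ((-g b).toNat : ℚ) := fun b => by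
      exact_mod_cast (Int.toNat_sub_toNat_neg (g b)).symm
    simp only [hg', sub_mul, Finset.sum_sub_distrib, sub_eq_zero] at ha
    exact_mod_cast ha
  intro b
  have hb : (g b).toNat = (-g b).toNat := congrFun h b
  omega

variable [DecidableEq A]

theorem splitBy_add_closure [Fintype A] {B : Finset (Vec A)} (hB : Independent B) (u : Vec A) :
    Free.splitBy {w | ∃ s ∈ AddSubmonoid.closure (B : Set (Vec A)), w = u + s} = ⊤ := by
  set M : ({b // b ∈ B} → ℚ) →ₗ[ℚ] (A → ℚ) :=
    Fintype.linearCombination ℚ fun b : {b // b ∈ B} => ratCast A b with hM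
  have hinj : Function.Injective M :=
    linearIndependent_iff_injective_fintypeLinearCombination.1 hB.linearIndependent
  obtain ⟨g, hg⟩ := M.exists_leftInverse_of_injective (LinearMap.ker_eq_bot.2 hinj)
  have hgM : ∀ x, g (M x) = x := fun x => LinearMap.congr_fun hg x
  have hMb : ∀ b : {b // b ∈ B}, M (Pi.single b 1) = ratCast A b := fun b => by
    simp [hM]
  -- `φ b` is the `b`-coordinate given by the left inverse `g`. Since `M ∘ g` projects onto the span
  -- of `B`, the maps `ψ a` together vanish exactly on the vectors in that span.
  let φ (b : {b // b ∈ B}) : Vec A →+ ℚ :=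
    ((LinearMap.proj b).comp g).toAddMonoidHom.comp (ratCast A)
  let ψ (a : A) : Vec A →+ ℚ :=
    ((LinearMap.proj a).comp (M.comp g - LinearMap.id)).toAddMonoidHom.comp (ratCast A)
  have hφ : ∀ b w, φ b w = g (ratCast A w) b := fun _ _ => rfl
  have hψ : ∀ a w, ψ a w = M (g (ratCast A w)) a - ratCast A w a := fun _ _ => rfl
  have key : {w | ∃ s ∈ AddSubmonoid.closure (B : Set (Vec A)), w = u + s} =
      (⋂ b, {w | ∃ n : ℕ, φ b w = φ b u + n}) ∩ ⋂ a, {w | ψ a u = ψ a w} := by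
    ext w
    simp only [Set.mem_ofPred_eq, Set.mem_inter_iff, Set.mem_iInter]
    constructor
    · rintro ⟨s, hs, rfl⟩
      suffices h : (∀ b, ∃ n : ℕ, φ b s = n) ∧ ∀ a, ψ a s = 0 by
        refine ⟨fun b => ?_, fun a => by rw [map_add, h.2, add_zero]⟩
        obtain ⟨n, hn⟩ := h.1 b
        exact ⟨n, by rw [map_add, hn]⟩
      induction hs using AddSubmonoid.closure_induction with
      | mem s hs =>
        have hs' := hMb ⟨s, hs⟩
        simp only at hs'
        refine ⟨fun b => ?_, fun a => by rw [hψ, ← hs', hgM, sub_self]⟩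
        rw [hφ, ← hs', hgM, Pi.single_apply]
        split_ifs
        exacts [⟨1, Nat.cast_one.symm⟩, ⟨0, Nat.cast_zero.symm⟩]
      | zero => exact ⟨fun b => ⟨0, by simp⟩, fun a => map_zero _⟩
      | add s t _ _ hs ht =>
        refine ⟨fun b => ?_, fun a => by rw [map_add, hs.2, ht.2, add_zero]⟩
        obtain ⟨m, hm⟩ := hs.1 b
        obtain ⟨n, hn⟩ := ht.1 b
        exact ⟨m + n, by rw [map_add, hm, hn, Nat.cast_add]⟩
    · rintro ⟨h, h'⟩
      choose n hn using h
      refine ⟨∑ b, n b • (b : Vec A), sum_mem fun b _ =>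
        AddSubmonoid.nsmul_mem _ (AddSubmonoid.subset_closure b.2) _, ratCast_injective ?_⟩
      have h1 : g (ratCast A w) = g (ratCast A u) + fun b => (n b : ℚ) := by
        ext b
        exact hn b
      have h2 : M (fun b => (n b : ℚ)) = ratCast A (∑ b, n b • (b : Vec A)) := by
        simp only [hM, Fintype.linearCombination_apply, map_sum, map_nsmul, Nat.cast_smul_eq_nsmul]
      ext a
      have h3 := h' a
      -- Substituting the coordinates of `w` cancels `M (g u)` and leaves `w = u + ∑ b, n b • b` at
      -- `a`.
      rw [hψ, hψ, h1, map_add, h2] at h3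
      rw [map_add]
      simp only [Pi.add_apply] at h3 ⊢
      linarith
  rw [key]
  exact Free.splitBy_inter (Free.splitBy_iInter fun b => Free.splitBy_eq_add_natCast (φ b) u)
    (Free.splitBy_iInter fun a => Free.splitBy_eq (ψ a) u)

end Linear

end CKA

theorem mainTheorem3 {A : Type*} [Fintype A] [DecidableEq A]
    (f : CKA.Expr A) (hf : CKA.IsUnambiguousLinear f) (e : CKA.Expr A) :
    ∃ eInter eDiff : CKA.Expr A,
      CKA.Provable e (CKA.Expr.join eInter eDiff) ∧
      CKA.sem eInter ⊆ CKA.sem f ∧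
      CKA.sem eDiff ⊆ CKA.sem e \ CKA.sem f := by
  obtain ⟨u, B, hB, hf⟩ := hf
  have hsem : CKA.sem f = {w | ∃ s ∈ AddSubmonoid.closure (B : Set (CKA.Vec A)), w = u + s} :=
    Set.ext fun _ => hf.mem_sem_iff
  obtain ⟨y, z, hyz, hy, hz⟩ : CKA.Free.mk e ∈ CKA.Free.splitBy (CKA.sem f) := by
    rw [hsem, CKA.splitBy_add_closure hB u]
    exact AddSubmonoid.mem_top _
  obtain ⟨eInter, rfl⟩ := CKA.Free.mk_surjective y
  obtain ⟨eDiff, rfl⟩ := CKA.Free.mk_surjective z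
  have h : CKA.Provable e (CKA.Expr.join eInter eDiff) := CKA.Free.mk_eq_mk.1 hyz
  refine ⟨eInter, eDiff, h, hy, fun w hw => ⟨?_, hz hw⟩⟩
  -- Soundness places the outer part inside `sem e`.
  rw [h.sem_eq]
  exact Or.inr hw
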